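/- Let $I$ be a finite index set and $A=(a_{ij})_{i,j\in I}$ a Cartan matrix of (twisted or untwisted) affine type, i.e. an indecomposable generalized Cartan matrix such that $A\,a=0$ for some vector $a=(a_i)_{i\in I}$ of positive integers. Let $P$ be a weight lattice for $A$ (an abelian group with simple roots $\alpha_i\in P$ and simple coroots $\alpha_i^\vee\in\operatorname{Hom}(P,\mathbb Z)$ such that $\langle\alpha_i^\vee,\alpha_j\rangle=a_{ij}$; for instance the affine weight lattice, or its quotient by the null root $\delta$). Let $B$ be a crystal with weights in $P$ (an affine crystal): a set with a weight function $\mathrm{wt}:B\to P$, raising and lowering operators $e_i,f_i:B\to B\sqcup\{0\}$ and functions $\varepsilon_i,\varphi_i:B\to\mathbb Z\sqcup\{-\infty\}$ ($i\in I$) satisfying Kashiwara's axioms: for all $i\in I$ and $b,b'\in B$, - $\varphi_i(b)=\varepsilon_i(b)+\langle\alpha_i^\vee,\mathrm{wt}(b)\rangle$; - if $e_i(b)\neq0$, then $\mathrm{wt}(e_i(b))=\mathrm{wt}(b)+\alpha_i$, $\varepsilon_i(e_i(b))=\varepsilon_i(b)-1$ and $\varphi_i(e_i(b))=\varphi_i(b)+1$;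 - if $f_i(b)\neq0$, then $\mathrm{wt}(f_i(b))=\mathrm{wt}(b)-\alpha_i$, $\varepsilon_i(f_i(b))=\varepsilon_i(b)+1$ and $\varphi_i(f_i(b))=\varphi_i(b)-1$; - $f_i(b)=b'$ if and only if $e_i(b')=b$; - if $\varphi_i(b)=-\infty$, then $e_i(b)=f_i(b)=0$. Assume that $B$ is seminormal, as crystal bases of integrable modules are: $\varepsilon_i(b)=\max\{k\ge0: e_i^k(b)\ne0\}$ and $\varphi_i(b)=\max\{k\ge0: f_i^k(b)\neq0\}$ for all $i\in I$, $b\in B$. Suppose that $B$ is finite and connected, i.e. $B$ is non-empty and any two elements are joined in the crystal graph (with an arrow $b\to f_i(b)$ whenever $f_i(b)\ne0$) by a path whose arrows may be traversed in either direction. Then $B$ is strongly connected: for any $b,b'\in B$ there are $r\ge0$ and $i_1,\dots,i_r\in I$ with $b'=f_{i_1}\cdots f_{i_r}(b)$. -/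

import Mathlib

namespace AffineCrystal

/-- `A` is a generalized Cartan matrix. -/
structure IsGeneralizedCartan {I : Type*} (A : Matrix I I ℤ) : Prop where
  diag : ∀ i, A i i = 2
  nonpos : ∀ i j, i ≠ j → A i j ≤ 0
  zero_symm : ∀ i j, A i j = 0 → A j i = 0

/-- `A` is indecomposable: the index set is non-empty and is not the disjoint union of two
non-empty subsets between which all entries vanish. -/
def IsIndecomposable {I : Type*} (A : Matrix I I ℤ) : Prop :=
  Nonempty I ∧ ∀ S : Set I, S.Nonempty → Sᶜ.Nonempty → ∃ i ∈ S, ∃ j ∈ Sᶜ, A i j ≠ 0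

/-- `A` is a Cartan matrix of (twisted or untwisted) affine type: an indecomposable generalized
Cartan matrix which annihilates some vector with positive entries (the labels `a_i`). -/
structure IsAffineCartan {I : Type*} [Fintype I] (A : Matrix I I ℤ) : Prop where
  isGeneralizedCartan : IsGeneralizedCartan A
  isIndecomposable : IsIndecomposable A
  exists_pos_null : ∃ a : I → ℤ, (∀ i, 0 < a i) ∧ A.mulVec a = 0

/-- A weight lattice `P` for the Cartan matrix `A`: simple roots `α_i ∈ P` and simple coroots
`α_i^∨ : P → ℤ` with `⟨α_i^∨, α_j⟩ = A i j`. Neither the simple roots nor the simple coroots need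
be linearly independent, so that this covers the weight lattice of an affine Kac--Moody algebra,
its quotient `P_cl` by the null root `δ` (the lattice of classical weights, which is where
the weights of crystals of finite-dimensional modules live), and the level zero part of the
latter. -/
structure WeightDatum {I : Type*} (A : Matrix I I ℤ) (P : Type*) [AddCommGroup P] where
  simpleRoot : I → P
  simpleCoroot : I → P →+ ℤ
  pairing : ∀ i j, simpleCoroot i (simpleRoot j) = A i j

/-- The `k`-th iterate of an operator `g : B → B ∪ {0}`, where `0` is `none` and `g 0 = 0`. -/
def opPow {B : Type*} (g : B → Option B) (k : ℕ) (b : B) : Option B :=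
  (fun x : Option B => x.bind g)^[k] (some b)

/-- A (Kashiwara) crystal for the weight datum `D`. The element `0` of `B ∪ {0}` is
`none : Option B`, and the value `-∞` is `⊥ : WithBot ℤ`. -/
structure Crystal {I : Type*} {A : Matrix I I ℤ} {P : Type*} [AddCommGroup P]
    (D : WeightDatum A P) (B : Type*) where
  wt : B → P
  /-- the raising operators -/
  e : I → B → Option B
  /-- the lowering operators -/
  f : I → B → Option B
  ε : I → B → WithBot ℤ
  φ : I → B → WithBot ℤ
  φ_eq : ∀ i b, φ i b = ε i b + ((D.simpleCoroot i (wt b) : ℤ) : WithBot ℤ)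
  wt_e : ∀ i b b', e i b = some b' → wt b' = wt b + D.simpleRoot i
  wt_f : ∀ i b b', f i b = some b' → wt b' = wt b - D.simpleRoot i
  ε_e : ∀ i b b', e i b = some b' → ε i b' + 1 = ε i b
  φ_e : ∀ i b b', e i b = some b' → φ i b' = φ i b + 1
  ε_f : ∀ i b b', f i b = some b' → ε i b' = ε i b + 1
  φ_f : ∀ i b b', f i b = some b' → φ i b' + 1 = φ i b
  f_eq_iff_e_eq : ∀ i b b', f i b = some b' ↔ e i b' = some b
  e_of_bot : ∀ i b, φ i b = ⊥ → e i b = none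
  f_of_bot : ∀ i b, φ i b = ⊥ → f i b = none

namespace Crystal

variable {I : Type*} {A : Matrix I I ℤ} {P : Type*} [AddCommGroup P] {D : WeightDatum A P}
  {B : Type*}

/-- The crystal is seminormal: `ε_i(b) = max {k ≥ 0 | e_i^k(b) ≠ 0}` and
`φ_i(b) = max {k ≥ 0 | f_i^k(b) ≠ 0}` for all `i` and `b`. This holds for the crystal bases of
integrable modules. -/
def IsSeminormal (C : Crystal D B) : Prop :=
  (∀ i b, ∃ m : ℕ, C.ε i b = ((m : ℤ) : WithBot ℤ) ∧
    IsGreatest {k : ℕ | opPow (C.e i) k b ≠ none} m) ∧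
  (∀ i b, ∃ m : ℕ, C.φ i b = ((m : ℤ) : WithBot ℤ) ∧
    IsGreatest {k : ℕ | opPow (C.f i) k b ≠ none} m)

/-- `b → b'` is an arrow of the crystal graph: `b' = f_i(b)` for some `i`. -/
def Arrow (C : Crystal D B) (b b' : B) : Prop := ∃ i, C.f i b = some b'

/-- The crystal is connected: it is non-empty and any two elements are joined by a sequence of
arrows of the crystal graph, each traversed in either direction. -/
def IsConnected (C : Crystal D B) : Prop :=
  Nonempty B ∧ ∀ b b' : B, Relation.EqvGen C.Arrow b b'

/-- `f_{i_1} (f_{i_2} (⋯ f_{i_r}(b)))` for the list `[i_1, …, i_r]`. -/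
def fWord (C : Crystal D B) (l : List I) (b : B) : Option B :=
  l.foldr (fun i x => x.bind (C.f i)) (some b)

/-- The crystal is strongly connected: for any two elements `b, b'` there are `i_1, …, i_r` with
`b' = f_{i_1} ⋯ f_{i_r}(b)`. -/
def IsStronglyConnected (C : Crystal D B) : Prop :=
  ∀ b b' : B, ∃ l : List I, C.fWord l b = some b'

end Crystal

end AffineCrystal

namespace AffineCrystal

/-! Let `S` be the set of elements reachable from `b` by lowering operators. Weighing the arrows of
each `i`-string shows that the weights in `S` have total pairing at most zero with every simple
coroot, with equality only if `S` is closed under `e i` (`sum_le_sum_of_closed`). A positive left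
null vector of `A` defines a level, constant on a connected crystal and zero by finiteness
(`level_eq_zero`). So a positive combination of these nonpositive totals vanishes, hence each does;
`S` is closed under all `e i`, and connectedness gives `S = B`. -/

/-- A Cartan matrix of affine type annihilates a positive row vector (the dual labels). -/
theorem IsAffineCartan.exists_pos_left_null {I : Type*} [Fintype I] {A : Matrix I I ℤ}
    (hA : IsAffineCartan A) : ∃ c : I → ℤ, (∀ i, 0 < c i) ∧ Matrix.vecMul c A = 0 := by
  classical
  obtain ⟨⟨hdiag, hnonpos, -⟩, ⟨⟨i₀⟩, hind⟩, a, ha, hAa⟩ := hA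
  have hdet : A.det = 0 :=
    Matrix.exists_mulVec_eq_zero_iff.1 ⟨a, fun h => (ha i₀).ne' (congrFun h i₀), hAa⟩
  obtain ⟨v, hv, hvA⟩ := Matrix.exists_vecMul_eq_zero_iff.2 hdet
  -- By the sign pattern of `A` and the triangle inequality, absolute values turn `v A = 0` into `c
  -- A ≤ 0`; pairing with the positive vector `a` then forces equality.
  let c : I → ℤ := fun i => |v i|
  have hle : ∀ j, Matrix.vecMul c A j ≤ 0 := by
    intro j
    have h1 : ∑ i, v i * A i j = 0 := congrFun hvA j
    change ∑ i, |v i| * A i j ≤ 0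
    rw [← Finset.add_sum_erase _ _ (Finset.mem_univ j), hdiag] at h1 ⊢
    have h2 : |∑ i ∈ Finset.univ.erase j, v i * A i j|
        ≤ -∑ i ∈ Finset.univ.erase j, |v i| * A i j := by
      refine (Finset.abs_sum_le_sum_abs _ _).trans_eq ?_
      rw [← Finset.sum_neg_distrib]
      refine Finset.sum_congr rfl fun i hi => ?_
      rw [abs_mul, abs_of_nonpos (hnonpos i j (Finset.ne_of_mem_erase hi)), mul_neg]
    have h3 : |∑ i ∈ Finset.univ.erase j, v i * A i j| = |v j| * 2 := by
      rw [eq_neg_of_add_eq_zero_right h1, abs_neg, abs_mul, abs_two]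
    linarith
  have hzero : Matrix.vecMul c A = 0 := by
    have hsum : ∑ j, Matrix.vecMul c A j * a j = 0 := by
      have h := Matrix.dotProduct_mulVec c A a
      rw [hAa, dotProduct_zero] at h
      exact h.symm
    have h := (Finset.sum_eq_zero_iff_of_nonpos fun j _ =>
      mul_nonpos_of_nonpos_of_nonneg (hle j) (ha j).le).1 hsum
    funext j
    exact (mul_eq_zero.1 (h j (Finset.mem_univ j))).resolve_right (ha j).ne'
  refine ⟨c, fun i => ?_, hzero⟩
  by_contra hi
  have hvi : v i = 0 := abs_nonpos_iff.1 (not_lt.1 hi)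
  obtain ⟨k, hk⟩ := Function.ne_iff.1 hv
  -- Column `l` lies in the zero set of `v`, so its diagonal term vanishes and the other terms, all
  -- nonpositive, must vanish too.
  obtain ⟨j, hj, l, hl, hjl⟩ := hind {j | v j ≠ 0} ⟨k, hk⟩ ⟨i, fun h => h hvi⟩
  have hvl : v l = 0 := not_not.1 hl
  have hterm : ∀ m ∈ Finset.univ, |v m| * A m l ≤ 0 := by
    intro m _
    rcases eq_or_ne m l with rfl | hm
    · simp [hvl]
    · exact mul_nonpos_of_nonneg_of_nonpos (abs_nonneg _) (hnonpos m l hm)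
  have h := (Finset.sum_eq_zero_iff_of_nonpos hterm).1 (congrFun hzero l) j (Finset.mem_univ j)
  exact (mul_eq_zero.1 h).elim (fun h => hj (abs_eq_zero.1 h)) hjl

/-- Let `S` be a finite union of lower ends of strings for mutually inverse partial maps `f`, `e`
with string functions `p` (distance to the lower end) and `q` (distance to the upper end). Then
`∑ p ≤ ∑ q` over `S`, and equality forces `S` to be closed under `e`. -/
theorem sum_le_sum_of_closed {B : Type*} {f e : B → Option B} {p q : B → ℤ}
    (hfe : ∀ b b', f b = some b' ↔ e b' = some b) (hp : ∀ b, 0 ≤ p b) (hq : ∀ b, 0 ≤ q b)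
    (hpf : ∀ b b', f b = some b' → p b = p b' + 1)
    (hqf : ∀ b b', f b = some b' → q b' = q b + 1) (hp0 : ∀ b, f b = none → p b = 0)
    (S : Finset B) (hS : ∀ b ∈ S, ∀ b', f b = some b' → b' ∈ S) :
    ∑ b ∈ S, p b ≤ ∑ b ∈ S, q b ∧
      (∑ b ∈ S, p b = ∑ b ∈ S, q b → ∀ b ∈ S, ∀ b', e b = some b' → b' ∈ S) := by
  classical
  -- An arrow `b → b'` gets weight `(q b + 1) * p b = q b' * (p b' + 1)`; `t b'` keeps only arrows
  -- with source in `S`. Since `(q + 1) * p - q * (p + 1) = p - q`, counting by source and by target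
  -- compares the two sums.
  let t : B → ℤ := fun b' => ∑ b ∈ S, if f b = some b' then q b' * (p b' + 1) else 0
  have hsum : ∑ b ∈ S, (q b + 1) * p b = ∑ b ∈ S, t b := by
    rw [Finset.sum_comm]
    refine Finset.sum_congr rfl fun b hb => ?_
    cases h : f b with
    | none => simp [hp0 b h]
    | some b' => simp [hS b hb b' h, hpf b b' h, hqf b b' h]
  have hnonneg : ∀ b, 0 ≤ q b * (p b + 1) := fun b =>
    mul_nonneg (hq b) (by linarith [hp b])
  have ht : ∀ b', t b' ≤ q b' * (p b' + 1) := by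
    intro b'
    cases h : e b' with
    | none => simpa [t, hfe, h] using hnonneg b'
    | some b =>
      by_cases hb : b ∈ S
      · simp [t, hfe, h, hb]
      · simpa [t, hfe, h, hb] using hnonneg b'
  have hdiff : ∑ b ∈ S, p b - ∑ b ∈ S, q b = ∑ b ∈ S, t b - ∑ b ∈ S, q b * (p b + 1) := by
    rw [← hsum, ← Finset.sum_sub_distrib, ← Finset.sum_sub_distrib]
    exact Finset.sum_congr rfl fun b _ => by ring
  have hle := Finset.sum_le_sum fun b (_ : b ∈ S) => ht b
  refine ⟨by linarith, fun heq b' hb' b h => ?_⟩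
  have heq' : ∑ b ∈ S, t b = ∑ b ∈ S, q b * (p b + 1) := by linarith
  have hb := (Finset.sum_eq_sum_iff_of_le fun b _ => ht b).1 heq' b' hb'
  by_contra hbS
  have h0 : t b' = 0 := by simp [t, hfe, h, hbS]
  have hpos : 0 < q b' * (p b' + 1) :=
    mul_pos (by linarith [hqf b b' ((hfe b b').2 h), hq b]) (by linarith [hp b'])
  linarith

theorem opPow_eq_none {B : Type*} {g : B → Option B} {b : B} (h : g b = none) {k : ℕ}
    (hk : k ≠ 0) : opPow g k b = none := by
  obtain ⟨k, rfl⟩ := Nat.exists_eq_succ_of_ne_zero hk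
  have h1 : opPow g (k + 1) b = (fun x : Option B => x.bind g)^[k] none := by
    rw [opPow, Function.iterate_succ_apply, Option.bind_some, h]
  exact h1.trans (Function.iterate_fixed rfl k)

namespace Crystal

variable {I : Type*} {A : Matrix I I ℤ} {P : Type*} [AddCommGroup P] {D : WeightDatum A P}
  {B : Type*} {C : Crystal D B}

/-- In a seminormal crystal the total weight of a finite set closed under `f i` is `i`-antidominant,
and it pairs to zero with the coroot only if the set is closed under `e i` as well. -/
theorem IsSeminormal.sum_simpleCoroot_nonpos (hC : C.IsSeminormal) (i : I) (S : Finset B)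
    (hS : ∀ b ∈ S, ∀ b', C.f i b = some b' → b' ∈ S) :
    ∑ b ∈ S, D.simpleCoroot i (C.wt b) ≤ 0 ∧
      (∑ b ∈ S, D.simpleCoroot i (C.wt b) = 0 → ∀ b ∈ S, ∀ b', C.e i b = some b' → b' ∈ S) := by
  choose q hq _ using hC.1 i
  choose p hp hpmax using hC.2 i
  have hwt : ∀ b, D.simpleCoroot i (C.wt b) = (p b : ℤ) - q b := by
    intro b
    have h := C.φ_eq i b
    rw [hp, hq] at h
    have h' : (p b : ℤ) = q b + D.simpleCoroot i (C.wt b) := by exact_mod_cast h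
    linarith
  have key := sum_le_sum_of_closed (f := C.f i) (e := C.e i) (p := fun b => (p b : ℤ))
    (q := fun b => (q b : ℤ)) (C.f_eq_iff_e_eq i) (fun _ => Int.natCast_nonneg _)
    (fun _ => Int.natCast_nonneg _)
    (fun b b' h => by
      have h := C.φ_f i b b' h
      rw [hp, hp] at h
      exact_mod_cast h.symm)
    (fun b b' h => by
      have h := C.ε_f i b b' h
      rw [hq, hq] at h
      exact_mod_cast h)
    (fun b h => by
      by_contra h0
      exact (hpmax b).1 (opPow_eq_none h (by exact_mod_cast h0)))
    S hS
  simp only [hwt, Finset.sum_sub_distrib]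
  exact ⟨sub_nonpos.2 key.1, fun h => key.2 (sub_eq_zero.1 h)⟩

/-- In a finite seminormal crystal the pairings with a simple coroot sum to zero. -/
theorem IsSeminormal.sum_univ_simpleCoroot [Fintype B] (hC : C.IsSeminormal) (i : I) :
    ∑ b, D.simpleCoroot i (C.wt b) = 0 := by
  choose q hq hqmax using hC.1 i
  choose p hp _ using hC.2 i
  refine le_antisymm (hC.sum_simpleCoroot_nonpos i Finset.univ fun _ _ _ _ =>
    Finset.mem_univ _).1 ?_
  have hwt : ∀ b, D.simpleCoroot i (C.wt b) = (p b : ℤ) - q b := by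
    intro b
    have h := C.φ_eq i b
    rw [hp, hq] at h
    have h' : (p b : ℤ) = q b + D.simpleCoroot i (C.wt b) := by exact_mod_cast h
    linarith
  -- All of `B` is also closed under `e i`, so exchanging `e` and `f` gives the reverse inequality.
  have key := sum_le_sum_of_closed (f := C.e i) (e := C.f i) (p := fun b => (q b : ℤ))
    (q := fun b => (p b : ℤ)) (fun b b' => (C.f_eq_iff_e_eq i b' b).symm)
    (fun _ => Int.natCast_nonneg _) (fun _ => Int.natCast_nonneg _)
    (fun b b' h => by
      have h := C.ε_e i b b' h
      rw [hq, hq] at h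
      exact_mod_cast h.symm)
    (fun b b' h => by
      have h := C.φ_e i b b' h
      rw [hp, hp] at h
      exact_mod_cast h)
    (fun b h => by
      by_contra h0
      exact (hqmax b).1 (opPow_eq_none h (by exact_mod_cast h0)))
    Finset.univ fun _ _ _ _ => Finset.mem_univ _
  simp only [hwt, Finset.sum_sub_distrib]
  exact sub_nonneg.2 key.1

/-- The level of the elements of a connected crystal is constant, where the level is the pairing
with a combination of coroots that annihilates all simple roots. -/
theorem IsConnected.level_eq [Fintype I] (hconn : C.IsConnected) {c : I → ℤ}
    (hc : Matrix.vecMul c A = 0) (b b' : B) :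
    ∑ i, c i * D.simpleCoroot i (C.wt b) = ∑ i, c i * D.simpleCoroot i (C.wt b') := by
  induction hconn.2 b b' with
  | rel x y h =>
    obtain ⟨j, hj⟩ := h
    have h0 : ∑ i, c i * A i j = 0 := congrFun hc j
    simp only [C.wt_f j x y hj, map_sub, D.pairing, mul_sub, Finset.sum_sub_distrib, h0, sub_zero]
  | refl x => rfl
  | symm x y _ ih => exact ih.symm
  | trans x y z _ _ ih₁ ih₂ => exact ih₁.trans ih₂

/-- The elements of a finite connected seminormal crystal have level zero. -/
theorem IsConnected.level_eq_zero [Fintype I] [Finite B] (hconn : C.IsConnected)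
    (hC : C.IsSeminormal) {c : I → ℤ} (hc : Matrix.vecMul c A = 0) (b : B) :
    ∑ i, c i * D.simpleCoroot i (C.wt b) = 0 := by
  have := Fintype.ofFinite B
  have hsum : ∑ b' : B, ∑ i, c i * D.simpleCoroot i (C.wt b') = 0 := by
    rw [Finset.sum_comm]
    simp only [← Finset.mul_sum, hC.sum_univ_simpleCoroot, mul_zero, Finset.sum_const_zero]
  rw [Finset.sum_congr rfl fun b' _ => hconn.level_eq hc b' b, Finset.sum_const,
    smul_eq_zero] at hsum
  have : Nonempty B := ⟨b⟩
  exact hsum.resolve_left (Finset.card_ne_zero.2 Finset.univ_nonempty)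

/-- A subset of a finite connected seminormal crystal of affine type which is closed under all `f i`
is closed under all `e i`. -/
theorem IsConnected.closed_e_of_closed_f [Fintype I] [Finite B] (hA : IsAffineCartan A)
    (hconn : C.IsConnected) (hC : C.IsSeminormal) {S : Set B}
    (hS : ∀ i, ∀ b ∈ S, ∀ b', C.f i b = some b' → b' ∈ S) (i : I) :
    ∀ b ∈ S, ∀ b', C.e i b = some b' → b' ∈ S := by
  classical
  have := Fintype.ofFinite B
  obtain ⟨c, hcpos, hc⟩ := hA.exists_pos_left_null
  have key := fun i => hC.sum_simpleCoroot_nonpos i S.toFinset (by simpa using hS i)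
  have hsum : ∑ i, c i * ∑ b ∈ S.toFinset, D.simpleCoroot i (C.wt b) = 0 := by
    simp only [Finset.mul_sum]
    rw [Finset.sum_comm]
    exact Finset.sum_eq_zero fun b _ => hconn.level_eq_zero hC hc b
  have h := (Finset.sum_eq_zero_iff_of_nonpos fun i _ =>
    mul_nonpos_of_nonneg_of_nonpos (hcpos i).le (key i).1).1 hsum i (Finset.mem_univ i)
  simpa using (key i).2 ((mul_eq_zero.1 h).resolve_left (hcpos i).ne')

end Crystal

end AffineCrystal

theorem mainTheorem8 {I : Type*} [Fintype I] {A : Matrix I I ℤ}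
    (hA : AffineCrystal.IsAffineCartan A)
    {P : Type*} [AddCommGroup P] (D : AffineCrystal.WeightDatum A P)
    {B : Type*} [Finite B] (C : AffineCrystal.Crystal D B)
    (hsemi : C.IsSeminormal) (hconn : C.IsConnected) :
    C.IsStronglyConnected := by
  intro b b'
  have hf : ∀ i, ∀ x ∈ {x | ∃ l, C.fWord l b = some x}, ∀ y, C.f i x = some y →
      y ∈ {x | ∃ l, C.fWord l b = some x} := by
    rintro i x ⟨l, hl⟩ y hy
    refine ⟨i :: l, ?_⟩
    change (C.fWord l b).bind (C.f i) = some y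
    rw [hl, Option.bind_some, hy]
  have he := hconn.closed_e_of_closed_f hA hsemi hf
  have hiff : ∀ x y, Relation.EqvGen C.Arrow x y →
      (x ∈ {x | ∃ l, C.fWord l b = some x} ↔ y ∈ {x | ∃ l, C.fWord l b = some x}) := by
    intro x y h
    induction h with
    | rel x y h =>
      obtain ⟨i, hi⟩ := h
      exact ⟨fun hx => hf i x hx y hi, fun hy => he i y hy x ((C.f_eq_iff_e_eq i x y).1 hi)⟩
    | refl x => rfl
    | symm x y _ ih => exact ih.symm
    | trans x y z _ _ ih₁ ih₂ => exact ih₁.trans ih₂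
  exact (hiff b b' (hconn.2 b b')).1 ⟨[], rfl⟩
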